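/- **Setting.** Distributed online convex optimization (D-OCO) with $n\ge 1$ learners, a central server, a feasible domain $\mathcal W\subseteq\mathbb R^d$ and $T$ rounds. In each round $t$ all learners play a common decision $\mathbf w^t\in\mathcal W$, and then learner $i$ is shown its loss $f_i^t:\mathbb R^d\to\mathbb R$. Every learner sends the server one vector, computed from its own losses $f_i^1,\dots,f_i^t$ and from the messages it has sent and received so far; the server receives the compressed vectors $\mathcal C(\cdot)$. The server then broadcasts one vector, computed from the messages it has received and sent so far; it reaches the learners either exactly or compressed by $\mathcal C$. The next decision is computed from the broadcasts received. A D-OCO algorithm consists of these (measurable) rules; it may use internal randomness and may depend on the compressor and on all parameters. A compressor is a random map $\mathcal C:\mathbb R^d\to\mathbb R^d$; in each round one independent draw of it compresses the messages of all learners, and another independent draw compresses the broadcast if that is compressed. For $\delta\in(0,1]$ it is $\delta$-contractive if $\mathbb E_{\mathcal C}\|\mathcal C(\mathbf x)-\mathbf x\|^2\le(1-\delta)\|\mathbf x\|^2$ for all $\mathbf x\in\mathbb R^d$. The losses are chosen by an adversary: $f_1^t,\dots,f_n^t$ may depend on the realized randomness of the compressor in rounds before $t$, but not on the internal randomness of the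 algorithm. The regret is $$R_T=\frac1n\sum_{t=1}^T\sum_{i=1}^n f_i^t(\mathbf w^t)-\min_{\mathbf w\in\mathcal W}\frac1n\sum_{t=1}^T\sum_{i=1}^n f_i^t(\mathbf w).$$ **Theorem.** Let $n,d\ge1$, $D,\mu>0$, $G\ge\mu D$, $\delta\in(0,1]$, $\mathcal W=[0,D/\sqrt d]^d$ and $T\ge(16+\delta)/\delta$. For every D-OCO algorithm, with exact or with compressed broadcasts, there exist a $\delta$-contractive compressor and a sequence of losses (chosen by an adversary as above) that are $\mu$-strongly convex over $\mathcal W$, i.e. differentiable with $f_i^t(\mathbf y)\ge f_i^t(\mathbf x)+\langle\nabla f_i^t(\mathbf x),\mathbf y-\mathbf x\rangle+\frac\mu2\|\mathbf y-\mathbf x\|^2$ for all $\mathbf x,\mathbf y\in\mathcal W$, and that satisfy $\|\nabla f_i^t(\mathbf w)\|\le G$ and $\|\frac1n\sum_{i}\nabla f_i^t(\mathbf w)\|\le G$ for all $\mathbf w\in\mathcal W$, such that $$\mathbb E[R_T]\ \ge\ \frac{\mu D^2\left(\log_{16}(15\,\delta T)-2\right)}{2^{18}\,\delta},$$ where the expectation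 is over the randomness of the compressor and of the algorithm. -/

import Mathlib

open MeasureTheory

noncomputable section

/-- Euclidean space `ℝ^d`. -/
abbrev Vec (d : ℕ) : Type := EuclideanSpace ℝ (Fin d)

/-- The feasible domain `[0, D / √d]^d`. -/
def cube (d : ℕ) (D : ℝ) : Set (Vec d) :=
  {w | ∀ j, 0 ≤ w j ∧ w j ≤ D / Real.sqrt d}

/-- `μ`-strong convexity of a differentiable function over `W`, in first-order form. -/
def StronglyConvexOver {d : ℕ} (W : Set (Vec d)) (μ : ℝ) (f : Vec d → ℝ) : Prop :=
  (∀ x ∈ W, DifferentiableAt ℝ f x) ∧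
  ∀ x ∈ W, ∀ y ∈ W,
    f x + inner ℝ (gradient f x) (y - x) + μ / 2 * ‖y - x‖ ^ 2 ≤ f y

/-- The gradients of the local losses, and of their average, are bounded by `G` over `W`. -/
def GradientsBounded {n d : ℕ} (W : Set (Vec d)) (G : ℝ) (f : Fin n → Vec d → ℝ) : Prop :=
  ∀ w ∈ W, (∀ i, ‖gradient (f i) w‖ ≤ G) ∧
    ‖(1 / (n : ℝ)) • ∑ i, gradient (f i) w‖ ≤ G

/-- A (randomized) compressor `𝒞 : ℝ^d → ℝ^d`: a random map, given by the space of its internal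
random outcomes, their law, and the value `map ω x` of `𝒞(x)` under the outcome `ω`. -/
structure Compressor (d : ℕ) where
  Outcome : Type
  [measurableOutcome : MeasurableSpace Outcome]
  law : Measure Outcome
  [isProbability : IsProbabilityMeasure law]
  map : Outcome → Vec d → Vec d
  measurable_map : Measurable (Function.uncurry map)

attribute [instance] Compressor.measurableOutcome Compressor.isProbability

/-- `δ`-contractive: `𝔼 ‖𝒞(x) - x‖² ≤ (1 - δ) ‖x‖²` for all `x`. -/
def Compressor.IsContractive {d : ℕ} (C : Compressor d) (δ : ℝ) : Prop :=
  ∀ x : Vec d, Integrable (fun ω => ‖C.map ω x - x‖ ^ 2) C.law ∧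
    ∫ ω, ‖C.map ω x - x‖ ^ 2 ∂C.law ≤ (1 - δ) * ‖x‖ ^ 2

/-- A (possibly randomized) D-OCO algorithm with `n` learners and feasible domain `W`. Rounds are
numbered from `0`. In round `t`:
* `decision` is the common decision `w^t ∈ W` of all learners, computed from the messages that the
  server broadcast in the earlier rounds;
* `uplink` is the vector that learner `i` passes to its compressor after the losses of round `t`
  have been revealed. It may depend on all its own losses of rounds `0, …, t` (as functions), on
  the compressed vectors it sent earlier, and on the broadcasts it received earlier;
* `broadcast` is the vector that the server sends out (or passes to its compressor), computed from
  the compressed vectors received from the learners in rounds `0, …, t` and from what was broadcast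
  earlier.
All parts may use a common random seed. -/
structure DOCOAlgorithm (n d : ℕ) (W : Set (Vec d)) where
  Seed : Type
  [measurableSeed : MeasurableSpace Seed]
  seedLaw : Measure Seed
  [isProbability : IsProbabilityMeasure seedLaw]
  decision : (t : ℕ) → Seed → (received : Fin t → Vec d) → Vec d
  uplink : (t : ℕ) → (i : Fin n) → Seed → (losses : Fin (t + 1) → Vec d → ℝ) →
    (sent : Fin t → Vec d) → (received : Fin t → Vec d) → Vec d
  broadcast : (t : ℕ) → Seed → (received : Fin (t + 1) → Fin n → Vec d) →
    (sent : Fin t → Vec d) → Vec d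
  decision_mem : ∀ t s b, decision t s b ∈ W
  measurable_decision : ∀ t,
    Measurable fun p : Seed × (Fin t → Vec d) => decision t p.1 p.2
  measurable_uplink : ∀ t i (f : Fin (t + 1) → Vec d → ℝ),
    Measurable fun p : Seed × (Fin t → Vec d) × (Fin t → Vec d) =>
      uplink t i p.1 f p.2.1 p.2.2
  measurable_broadcast : ∀ t,
    Measurable fun p : Seed × (Fin (t + 1) → Fin n → Vec d) × (Fin t → Vec d) =>
      broadcast t p.1 p.2.1 p.2.2

attribute [instance] DOCOAlgorithm.measurableSeed DOCOAlgorithm.isProbability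

/-- Does the server also compress what it broadcasts (bidirectional compression), or not
(unidirectional compression)? -/
inductive Downlink where
  | exact
  | compressed

/-- What the learners receive when the server sends `x`. -/
def Downlink.transmit {d : ℕ} (link : Downlink) (C : Compressor d) (ω : C.Outcome) (x : Vec d) :
    Vec d :=
  match link with
  | .exact => x
  | .compressed => C.map ω x

/-- The random outcomes of the compressor over `T` rounds: in each round one for the learners'
messages to the server and one for the server's broadcast. -/
abbrev Compressor.Outcomes {d : ℕ} (C : Compressor d) (T : ℕ) : Type :=
  Fin T → C.Outcome × C.Outcome

/-- The outcomes are drawn afresh, independently and from the same law, every time. -/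
def Compressor.outcomesLaw {d : ℕ} (C : Compressor d) (T : ℕ) : Measure (C.Outcomes T) :=
  Measure.pi fun _ => C.law.prod C.law

/-- The messages of one round: the compressed vector that each learner sent to the server, and
the vector that all learners received from the server. -/
structure RoundMessages (n d : ℕ) where
  up : Fin n → Vec d
  down : Vec d

/-- The messages exchanged in the first `t` of `T` rounds, when `f s i` is the loss of learner `i`
in round `s`, `ω` are the outcomes of the compressor and `r` is the seed of the algorithm. -/
def transcript {n d : ℕ} {W : Set (Vec d)} (A : DOCOAlgorithm n d W) (C : Compressor d)
    (link : Downlink) {T : ℕ} (f : Fin T → Fin n → Vec d → ℝ) (ω : C.Outcomes T) (r : A.Seed) :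
    (t : ℕ) → t ≤ T → Fin t → RoundMessages n d
  | 0, _ => Fin.elim0
  | t + 1, h =>
    let past : Fin t → RoundMessages n d :=
      transcript A C link f ω r t (Nat.le_of_succ_le h)
    let up : Fin n → Vec d := fun i =>
      C.map (ω ⟨t, h⟩).1
        (A.uplink t i r (fun s => f (Fin.castLE h s) i) (fun s => (past s).up i)
          (fun s => (past s).down))
    let down : Vec d :=
      link.transmit C (ω ⟨t, h⟩).2
        (A.broadcast t r (Fin.snoc (α := fun _ => Fin n → Vec d) (fun s => (past s).up) up)
          (fun s => (past s).down))
    Fin.snoc (α := fun _ => RoundMessages n d) past ⟨up, down⟩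

/-- The decision `w^t` that is played in round `t`. -/
def played {n d : ℕ} {W : Set (Vec d)} (A : DOCOAlgorithm n d W) (C : Compressor d)
    (link : Downlink) {T : ℕ} (f : Fin T → Fin n → Vec d → ℝ) (ω : C.Outcomes T) (r : A.Seed)
    (t : Fin T) : Vec d :=
  A.decision t r fun s => (transcript A C link f ω r t t.isLt.le s).down

/-- The adversary's choice of loss functions. The losses of round `t` may depend on the outcomes of
the compressor in the earlier rounds (and on nothing else that is random). -/
abbrev Adversary {d : ℕ} (C : Compressor d) (n T : ℕ) : Type :=
  (t : Fin T) → (Fin (t : ℕ) → C.Outcome × C.Outcome) → Fin n → Vec d → ℝ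

/-- The loss functions that the adversary plays under the outcomes `ω`. -/
def Adversary.losses {d : ℕ} {C : Compressor d} {n T : ℕ} (adv : Adversary C n T)
    (ω : C.Outcomes T) : Fin T → Fin n → Vec d → ℝ :=
  fun t => adv t fun s => ω (Fin.castLE t.isLt.le s)

/-- The regret `(1/n) ∑ₜ ∑ᵢ fᵢᵗ(wᵗ) - min_{w ∈ W} (1/n) ∑ₜ ∑ᵢ fᵢᵗ(w)` of the decisions `w`. -/
def regret {n d T : ℕ} (W : Set (Vec d)) (f : Fin T → Fin n → Vec d → ℝ) (w : Fin T → Vec d) :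
    ℝ :=
  (1 / (n : ℝ)) * ∑ t, ∑ i, f t i (w t) -
    ⨅ u : W, (1 / (n : ℝ)) * ∑ t, ∑ i, f t i (u : Vec d)

/-- The regret of the algorithm `A` as a random variable: a function of the algorithm's seed and
the outcomes of the compressor. -/
def algorithmRegret {n d : ℕ} {W : Set (Vec d)} (A : DOCOAlgorithm n d W) (C : Compressor d)
    (link : Downlink) {T : ℕ} (adv : Adversary C n T) (p : A.Seed × C.Outcomes T) : ℝ :=
  regret W (adv.losses p.2) (played A C link (adv.losses p.2) p.2 p.1)

end

/-! The compressor that forwards its input with probability `δ` and otherwise sends `0` is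
`δ`-contractive. Under it, decisions learn about the losses only through rounds whose uplink
succeeds, whether or not broadcasts are compressed. The adversary repeats one quadratic loss until
an uplink gets through and then draws a new one, so each loss is charged for about `1 / δ` rounds.

The minimizers are `0` or the opposite vertex of the cube, according to bits `x₀, x₁, …`. Projection
onto the diagonal (`quadLoss_corner_ge`) reduces the game to predicting bits under squared loss.
After `N` successful uplinks the current bit is `x_N` and the decision is a function of `x₀, …,
x_{N-1}` (`played_bitAdversary_congr`). For independent bits of mean `p`, with `p` uniform on `[0,
1]`, the best such prediction is Laplace's `(m + 1) / (N + 2)`, and its excess over the constant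
prediction `p` averages `1 / (6 (N + 2))` (`le_integral_bitMean_excess`).

Before round `t` the mean of `N` is `δ t`. By convexity of `1 / m` the expected regret, averaged
over the bits, is at least `μ D² / 12 * ∑ₜ 1 / (δ t + 2)`, which is of order `log (δ T) / δ`
(`log_div_le_sum`). Some fixed bit string does at least as well as the average. -/

/-! ### Bayesian prediction of Bernoulli bits with uniform prior on the mean. -/

/-- The law on bit strings under which the bits in `s` have mean `p` and the others are fair. -/
noncomputable def bitWeight {ι : Type*} [Fintype ι] [DecidableEq ι] (s : Finset ι) (p : ℝ)
    (x : ι → Bool) : ℝ :=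
  ∏ i, if i ∈ s then (if x i then p else 1 - p) else 1 / 2

/-- The value of a bit as a real number. -/
noncomputable def bitValue (b : Bool) : ℝ := if b then 1 else 0

/-- The expectation of `F` under `bitWeight s p`. -/
noncomputable def bitMean {ι : Type*} [Fintype ι] [DecidableEq ι] (s : Finset ι) (p : ℝ)
    (F : (ι → Bool) → ℝ) : ℝ :=
  ∑ x, bitWeight s p x * F x

lemma sum_update_of_notMem {ι : Type*} [DecidableEq ι] {s : Finset ι} {k : ι} (hk : k ∉ s)
    (f : Bool → ℝ) (x : ι → Bool) (b : Bool) : ∑ i ∈ s, f (Function.update x k b i) = ∑ i ∈ s, f (x i) :=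
  Finset.sum_congr rfl fun i hi => by
    rw [Function.update_of_ne (ne_of_mem_of_not_mem hi hk)]

/-- The estimate `(m + 1) / (|s| + 2)` of the mean when `m` of the bits in `s` are set. -/
noncomputable def laplaceEstimate {ι : Type*} (s : Finset ι) (x : ι → Bool) : ℝ :=
  (∑ i ∈ s, bitValue (x i) + 1) / (s.card + 2)

lemma laplaceEstimate_sub {ι : Type*} (s : Finset ι) (x : ι → Bool) (p : ℝ) :
    laplaceEstimate s x - p =
      (∑ i ∈ s, (bitValue (x i) - p) + (1 - 2 * p)) / (s.card + 2) := by
  have : (s.card : ℝ) + 2 ≠ 0 := by positivity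
  rw [laplaceEstimate, Finset.sum_sub_distrib, Finset.sum_const, nsmul_eq_mul]
  field_simp
  ring

section BitMean

variable {ι : Type*} [Fintype ι] [DecidableEq ι]

lemma bitWeight_nonneg (s : Finset ι) {p : ℝ} (hp : p ∈ Set.Icc (0 : ℝ) 1) (x : ι → Bool) :
    0 ≤ bitWeight s p x := by
  refine Finset.prod_nonneg fun i _ => ?_
  have := hp.1
  have := hp.2
  split_ifs <;> linarith

lemma continuous_bitWeight (s : Finset ι) (x : ι → Bool) :
    Continuous fun p : ℝ => bitWeight s p x := by
  refine continuous_finsetProd _ fun i _ => ?_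
  split_ifs <;> fun_prop

lemma continuous_bitMean (s : Finset ι) {F : ℝ → (ι → Bool) → ℝ}
    (hF : ∀ x, Continuous fun p => F p x) : Continuous fun p : ℝ => bitMean s p (F p) :=
  continuous_finsetSum _ fun x _ => (continuous_bitWeight s x).mul (hF x)

lemma bitMean_add (s : Finset ι) (p : ℝ) (F H : (ι → Bool) → ℝ) :
    bitMean s p (fun x => F x + H x) = bitMean s p F + bitMean s p H := by
  simp [bitMean, mul_add, Finset.sum_add_distrib]

lemma bitMean_const_mul (s : Finset ι) (p c : ℝ) (F : (ι → Bool) → ℝ) :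
    bitMean s p (fun x => c * F x) = c * bitMean s p F := by
  simp only [bitMean, Finset.mul_sum]
  exact Finset.sum_congr rfl fun x _ => by ring

lemma bitMean_mono (s : Finset ι) {p : ℝ} (hp : p ∈ Set.Icc (0 : ℝ) 1) {F H : (ι → Bool) → ℝ}
    (h : ∀ x, F x ≤ H x) : bitMean s p F ≤ bitMean s p H :=
  Finset.sum_le_sum fun x _ => mul_le_mul_of_nonneg_left (h x) (bitWeight_nonneg s hp x)

/-- Independence of the bit `k` from the others. The inserted bit changes from fair to mean `p`,
which `F` cannot notice; this drives all inductions on `s` below. -/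
lemma bitMean_insert {s : Finset ι} {k : ι} (hk : k ∉ s) (p : ℝ) {F : (ι → Bool) → ℝ}
    (hF : ∀ x b, F (Function.update x k b) = F x) (g : Bool → ℝ) :
    bitMean (insert k s) p (fun x => F x * g (x k)) =
      (p * g true + (1 - p) * g false) * bitMean s p F := by
  -- Strings are paired by flipping the bit `k`; the identity then holds pair by pair.
  set flip : (ι → Bool) → ι → Bool := fun x => Function.update x k (!x k) with hflip
  have hinv : Function.Involutive flip := fun x => by simp [hflip]
  have havg : ∀ φ : (ι → Bool) → ℝ, ∑ x, φ x = ∑ x, (φ x + φ (flip x)) / 2 := by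
    intro φ
    have : ∑ x, φ (flip x) = ∑ x, φ x := Equiv.sum_comp hinv.toPerm φ
    rw [← Finset.sum_div, Finset.sum_add_distrib, this]
    ring
  set c : (ι → Bool) → ℝ := fun x =>
    ∏ i ∈ Finset.univ.erase k, if i ∈ s then (if x i then p else 1 - p) else 1 / 2 with hc
  have hcflip : ∀ x, c (flip x) = c x := by
    intro x
    refine Finset.prod_congr rfl fun i hi => ?_
    simp [hflip, Function.update_of_ne (Finset.ne_of_mem_erase hi)]
  have hw : ∀ x, bitWeight (insert k s) p x = (if x k then p else 1 - p) * c x := by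
    intro x
    rw [bitWeight, ← Finset.mul_prod_erase _ _ (Finset.mem_univ k)]
    congr 1
    · simp
    · refine Finset.prod_congr rfl fun i hi => ?_
      simp [Finset.mem_insert, Finset.ne_of_mem_erase hi]
  have hw' : ∀ x, bitWeight s p x = 1 / 2 * c x := by
    intro x
    rw [bitWeight, ← Finset.mul_prod_erase _ _ (Finset.mem_univ k)]
    simp [hk, hc]
  have hFflip : ∀ x, F (flip x) = F x := fun x => hF x _
  have hk' : ∀ x, flip x k = !x k := fun x => by simp [hflip]
  rw [bitMean, bitMean, havg, Finset.mul_sum]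
  refine Finset.sum_congr rfl fun x _ => ?_
  rw [hw, hw, hw', hcflip, hFflip, hk']
  cases x k <;> simp <;> ring

lemma bitMean_insert_of_indep {s : Finset ι} {k : ι} (hk : k ∉ s) (p : ℝ) {F : (ι → Bool) → ℝ}
    (hF : ∀ x b, F (Function.update x k b) = F x) :
    bitMean (insert k s) p F = bitMean s p F := by
  simpa using bitMean_insert hk p hF fun _ => 1

lemma bitMean_univ_of_indep {s : Finset ι} (p : ℝ) {F : (ι → Bool) → ℝ}
    (hF : ∀ j ∉ s, ∀ x b, F (Function.update x j b) = F x) :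
    bitMean Finset.univ p F = bitMean s p F := by
  have h : ∀ u : Finset ι, bitMean (u ∪ s) p F = bitMean s p F := by
    intro u
    induction u using Finset.induction_on with
    | empty => simp
    | insert j u hj ih =>
      rw [Finset.insert_union]
      by_cases hjs : j ∈ u ∪ s
      · rwa [Finset.insert_eq_of_mem hjs]
      · rw [bitMean_insert_of_indep hjs p (hF j fun h => hjs (Finset.mem_union_right _ h)), ih]
  rw [← h Finset.univ, Finset.union_eq_left.2 (Finset.subset_univ s)]

lemma bitMean_empty_const (p c : ℝ) : bitMean (∅ : Finset ι) p (fun _ => c) = c := by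
  simp [bitMean, bitWeight]

lemma bitMean_const (s : Finset ι) (p c : ℝ) : bitMean s p (fun _ => c) = c := by
  induction s using Finset.induction_on with
  | empty => exact bitMean_empty_const p c
  | insert k s hk ih => rw [bitMean_insert_of_indep hk p fun _ _ => rfl, ih]

lemma bitMean_deviation (s : Finset ι) (p : ℝ) :
    bitMean s p (fun x => ∑ i ∈ s, (bitValue (x i) - p)) = 0 := by
  induction s using Finset.induction_on with
  | empty => simpa using bitMean_empty_const p 0
  | insert k s hk ih =>
    have h1 := bitMean_insert hk p (F := fun _ => 1) (fun _ _ => rfl) fun b => bitValue b - p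
    have h2 := bitMean_insert_of_indep hk p
      (F := fun x => ∑ i ∈ s, (bitValue (x i) - p)) (sum_update_of_notMem hk fun b => bitValue b - p)
    simp only [Finset.sum_insert hk, bitMean_add, h2, ih]
    simp only [one_mul, bitMean_const] at h1
    rw [h1]
    simp [bitValue]
    ring

lemma bitMean_deviation_sq (s : Finset ι) (p : ℝ) :
    bitMean s p (fun x => (∑ i ∈ s, (bitValue (x i) - p)) ^ 2) = s.card * (p * (1 - p)) := by
  induction s using Finset.induction_on with
  | empty => simpa using bitMean_empty_const p 0
  | insert k s hk ih =>
    have hs := sum_update_of_notMem hk fun b => bitValue b - p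
    have h1 := bitMean_insert hk p (F := fun _ => 1) (fun _ _ => rfl)
      fun b => (bitValue b - p) ^ 2
    have h2 := bitMean_insert hk p (F := fun x => ∑ i ∈ s, (bitValue (x i) - p)) hs
      fun b => 2 * (bitValue b - p)
    have h3 := bitMean_insert_of_indep hk p
      (F := fun x => (∑ i ∈ s, (bitValue (x i) - p)) ^ 2) fun x b => by simp only [hs]
    have : (fun x : ι → Bool => (∑ i ∈ insert k s, (bitValue (x i) - p)) ^ 2) = fun x =>
        (1 * (bitValue (x k) - p) ^ 2 +
          (∑ i ∈ s, (bitValue (x i) - p)) * (2 * (bitValue (x k) - p))) +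
          (∑ i ∈ s, (bitValue (x i) - p)) ^ 2 := by
      ext x
      rw [Finset.sum_insert hk]
      ring
    rw [this, bitMean_add, bitMean_add, h1, h2, h3, ih, bitMean_const, bitMean_deviation,
      Finset.card_insert_of_notMem hk]
    simp [bitValue]
    ring

lemma bitMean_laplaceEstimate_sub_sq (s : Finset ι) (p : ℝ) :
    bitMean s p (fun x => (laplaceEstimate s x - p) ^ 2) =
      (s.card * (p * (1 - p)) + (1 - 2 * p) ^ 2) / (s.card + 2 : ℝ) ^ 2 := by
  have : (fun x => (laplaceEstimate s x - p) ^ 2) = fun x => (1 / (s.card + 2 : ℝ) ^ 2) *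
      ((∑ i ∈ s, (bitValue (x i) - p)) ^ 2 +
        ((2 * (1 - 2 * p)) * (∑ i ∈ s, (bitValue (x i) - p)) + (1 - 2 * p) ^ 2)) := by
    ext x
    rw [laplaceEstimate_sub, div_pow]
    ring
  rw [this, bitMean_const_mul, bitMean_add, bitMean_add, bitMean_const_mul, bitMean_deviation,
    bitMean_deviation_sq, bitMean_const]
  ring

/-- Since `p (1 - p)` integrates to `1 / 6` and `(1 - 2 p)²` to `1 / 3`, the numerator integrates to
`(k + 2) / 6`. -/
lemma integral_laplace_variance (k : ℕ) :
    ∫ p in (0 : ℝ)..1, (k * (p * (1 - p)) + (1 - 2 * p) ^ 2) / (k + 2 : ℝ) ^ 2 =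
      1 / (6 * (k + 2 : ℝ)) := by
  have hd : ∀ p ∈ Set.uIcc (0 : ℝ) 1, HasDerivAt (fun p : ℝ =>
      (k * (p ^ 2 / 2 - p ^ 3 / 3) + (p - 2 * p ^ 2 + 4 * p ^ 3 / 3)) / (k + 2 : ℝ) ^ 2)
      ((k * (p * (1 - p)) + (1 - 2 * p) ^ 2) / (k + 2 : ℝ) ^ 2) p := by
    intro p _
    have h1 := hasDerivAt_id' p
    have h2 := hasDerivAt_pow 2 p
    have h3 := hasDerivAt_pow 3 p
    refine (((((h2.div_const 2).sub (h3.div_const 3)).const_mul (k : ℝ)).add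
      ((h1.sub (h2.const_mul 2)).add ((h3.const_mul 4).div_const 3))).div_const
        ((k + 2 : ℝ) ^ 2)).congr_deriv ?_
    norm_num
    ring
  rw [intervalIntegral.integral_eq_sub_of_hasDerivAt hd
    (Continuous.intervalIntegrable (by fun_prop) _ _)]
  have : (k : ℝ) + 2 ≠ 0 := by positivity
  field_simp
  ring

lemma bitWeight_eq_pow (s : Finset ι) (p : ℝ) (x : ι → Bool) :
    bitWeight s p x = (1 / 2) ^ sᶜ.card *
      (p ^ (s.filter fun i => x i = true).card *
        (1 - p) ^ (s.filter fun i => ¬ x i = true).card) := by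
  rw [bitWeight, Finset.prod_ite, mul_comm]
  congr 1
  · rw [Finset.prod_const]
    congr 2
    ext
    simp
  · have : (Finset.univ.filter fun i => i ∈ s) = s := by ext; simp
    rw [this, Finset.prod_ite, Finset.prod_const, Finset.prod_const]

/-- Under the uniform prior, Laplace's estimate is the posterior mean of `p` given the bits in `s`.
-/
lemma integral_bitWeight_mul_laplaceEstimate_sub (s : Finset ι) (x : ι → Bool) :
    ∫ p in (0 : ℝ)..1, bitWeight s p x * (laplaceEstimate s x - p) = 0 := by
  set m := (s.filter fun i => x i = true).card
  set l := (s.filter fun i => ¬ x i = true).card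
  have hcard : (s.card : ℝ) = m + l := by
    exact_mod_cast (Finset.card_filter_add_card_filter_not (s := s) fun i => x i = true).symm
  have hsum : ∑ i ∈ s, bitValue (x i) = m := by simp [bitValue, m]
  -- Both exponents in this antiderivative are positive, so it vanishes at `0` and at `1`.
  have hd : ∀ p ∈ Set.uIcc (0 : ℝ) 1, HasDerivAt (fun p : ℝ =>
      (1 / 2 : ℝ) ^ sᶜ.card * (p ^ (m + 1) * (1 - p) ^ (l + 1)) / (m + l + 2))
      (bitWeight s p x * (laplaceEstimate s x - p)) p := by
    intro p _
    have h1 := hasDerivAt_pow (m + 1) p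
    have h2 := ((hasDerivAt_id' p).const_sub 1).pow (l + 1)
    refine (((h1.mul h2).const_mul ((1 / 2 : ℝ) ^ sᶜ.card)).div_const
      (m + l + 2 : ℝ)).congr_deriv ?_
    rw [bitWeight_eq_pow, laplaceEstimate, hsum, hcard]
    have : (m : ℝ) + l + 2 ≠ 0 := by positivity
    push_cast
    simp only [Pi.pow_apply]
    field_simp
    ring
  rw [intervalIntegral.integral_eq_sub_of_hasDerivAt hd
    (((continuous_bitWeight s x).mul (by fun_prop)).intervalIntegrable _ _)]
  simp

/-- Predicting a bit from the bits in `s` costs, on average over a uniform mean `p`, more than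
predicting it by `p`. -/
lemma le_integral_bitMean_excess {s : Finset ι} {k : ι} (hk : k ∉ s) {a : (ι → Bool) → ℝ}
    (ha : ∀ j ∉ s, ∀ x b, a (Function.update x j b) = a x) :
    1 / (6 * (s.card + 2 : ℝ)) ≤ ∫ p in (0 : ℝ)..1, bitMean Finset.univ p
      (fun x => (a x - bitValue (x k)) ^ 2 - (p - bitValue (x k)) ^ 2) := by
  -- The cross term `2 (a - p) (p - x k)` has mean zero because `a` does not depend on the bit `k`.
  have hred : ∀ p, bitMean Finset.univ p
      (fun x => (a x - bitValue (x k)) ^ 2 - (p - bitValue (x k)) ^ 2) =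
      bitMean s p fun x => (a x - p) ^ 2 := by
    intro p
    have h1 := bitMean_insert_of_indep hk p (F := fun x => (a x - p) ^ 2)
      fun x b => by rw [ha k hk]
    have h2 := bitMean_insert hk p (F := fun x => a x - p) (fun x b => by rw [ha k hk])
      fun b => 2 * (p - bitValue b)
    rw [bitMean_univ_of_indep (s := insert k s) p]
    · have : (fun x => (a x - bitValue (x k)) ^ 2 - (p - bitValue (x k)) ^ 2) = fun x =>
          (a x - p) ^ 2 + (a x - p) * (2 * (p - bitValue (x k))) := by
        ext x
        ring
      rw [this, bitMean_add, h1, h2]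
      simp [bitValue]
      left
      ring
    · intro j hj x b
      rw [Finset.mem_insert, not_or] at hj
      rw [ha j hj.2, Function.update_of_ne (Ne.symm hj.1)]
  simp only [hred]
  -- For fixed `x` the factor `a - laplaceEstimate` is constant in `p`, so orthogonality to the
  -- posterior applies string by string.
  have hcross : ∫ p in (0 : ℝ)..1, bitMean s p (fun x =>
      2 * (a x - laplaceEstimate s x) * (laplaceEstimate s x - p)) = 0 := by
    simp only [bitMean]
    rw [intervalIntegral.integral_finsetSum]
    swap
    · exact fun x _ => Continuous.intervalIntegrable
        ((continuous_bitWeight s x).mul (by fun_prop)) _ _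
    refine Finset.sum_eq_zero fun x _ => ?_
    have h := intervalIntegral.integral_const_mul (μ := volume) (a := 0) (b := 1)
      (2 * (a x - laplaceEstimate s x)) fun p => bitWeight s p x * (laplaceEstimate s x - p)
    rw [integral_bitWeight_mul_laplaceEstimate_sub, mul_zero] at h
    rw [← h]
    congr 1
    ext p
    ring
  have hvar : ∫ p in (0 : ℝ)..1, bitMean s p (fun x => (laplaceEstimate s x - p) ^ 2) =
      1 / (6 * (s.card + 2 : ℝ)) := by
    simp only [bitMean_laplaceEstimate_sub_sq]
    exact integral_laplace_variance s.card
  have hc1 : Continuous fun p : ℝ => bitMean s p (fun x =>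
      2 * (a x - laplaceEstimate s x) * (laplaceEstimate s x - p)) :=
    continuous_bitMean s fun x => by fun_prop
  have hc2 : Continuous fun p : ℝ => bitMean s p (fun x => (laplaceEstimate s x - p) ^ 2) :=
    continuous_bitMean s fun x => by fun_prop
  have hsplit := intervalIntegral.integral_add (hc1.intervalIntegrable (μ := volume) 0 1)
    (hc2.intervalIntegrable 0 1)
  rw [hcross, hvar, zero_add] at hsplit
  rw [← hsplit]
  refine intervalIntegral.integral_mono_on zero_le_one ((hc1.add hc2).intervalIntegrable _ _)
    ((continuous_bitMean s fun x => by fun_prop).intervalIntegrable _ _) fun p hp => ?_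
  rw [← bitMean_add]
  -- What is discarded is `(a - laplaceEstimate)²`.
  refine bitMean_mono s hp fun x => ?_
  nlinarith [sq_nonneg (a x - laplaceEstimate s x)]

end BitMean

/-! ### Counting successful uplinks. -/

/-- The number of rounds in which the uplink outcome satisfies `ok`. -/
def successCount {α : Type*} (ok : α → Bool) {t : ℕ} (h : Fin t → α × α) : ℕ :=
  Nat.count (fun s => ∃ hs : s < t, ok (h ⟨s, hs⟩).1 = true) t

lemma successCount_le {α : Type*} (ok : α → Bool) {t : ℕ} (h : Fin t → α × α) :
    successCount ok h ≤ t :=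
  Nat.count_le _

lemma successCount_castLE {α : Type*} (ok : α → Bool) {t T : ℕ} (ht : t ≤ T)
    (ω : Fin T → α × α) :
    successCount ok (fun s : Fin t => ω (Fin.castLE ht s)) =
      Nat.count (fun s => ∃ hs : s < T, ok (ω ⟨s, hs⟩).1 = true) t := by
  rw [successCount, Nat.count_eq_card_filter_range, Nat.count_eq_card_filter_range]
  congr 1
  refine Finset.filter_congr fun s hs => ?_
  have hst := Finset.mem_range.1 hs
  simp [Fin.castLE, hst, hst.trans_le ht]

lemma successCount_mono {α : Type*} (ok : α → Bool) {s t T : ℕ} (hst : s ≤ t) (ht : t ≤ T)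
    (ω : Fin T → α × α) :
    successCount ok (fun j : Fin s => ω (Fin.castLE (hst.trans ht) j)) ≤
      successCount ok (fun j : Fin t => ω (Fin.castLE ht j)) := by
  rw [successCount_castLE, successCount_castLE]
  exact Nat.count_monotone _ hst

lemma successCount_lt {α : Type*} (ok : α → Bool) {s t T : ℕ} (hst : s < t) (ht : t ≤ T)
    (ω : Fin T → α × α) (hs : ok (ω ⟨s, hst.trans_le ht⟩).1 = true) :
    successCount ok (fun j : Fin s => ω (Fin.castLE (hst.le.trans ht) j)) <
      successCount ok (fun j : Fin t => ω (Fin.castLE ht j)) := by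
  rw [successCount_castLE, successCount_castLE]
  exact Nat.count_strict_mono ⟨hst.trans_le ht, hs⟩ hst

lemma successCount_eq_sum {α : Type*} (ok : α → Bool) {t : ℕ} (h : Fin t → α × α) :
    (successCount ok h : ℝ) = ∑ s, if ok (h s).1 = true then (1 : ℝ) else 0 := by
  rw [successCount, Nat.count_eq_card_filter_range, Finset.card_filter, Nat.cast_sum,
    Finset.sum_range]
  refine Finset.sum_congr rfl fun s _ => ?_
  simp

/-! ### What the messages can depend on, and their measurability. -/

section Transcript

variable {n d T : ℕ} {W : Set (Vec d)} (A : DOCOAlgorithm n d W) (C : Compressor d)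
  (link : Downlink)

/-- If the compressor transmits nothing in the rounds that are not `ok`, then the messages depend
only on the losses that precede some `ok` round. -/
lemma transcript_congr {ok : C.Outcome → Bool} (hok : ∀ ω x, ok ω = false → C.map ω x = 0)
    (f f' : Fin T → Fin n → Vec d → ℝ) (ω : C.Outcomes T) (r : A.Seed) (t : ℕ) (ht : t ≤ T)
    (h : ∀ s : Fin T, (s : ℕ) < t → ok (ω s).1 = true → ∀ s' ≤ s, f s' = f' s') :
    transcript A C link f ω r t ht = transcript A C link f' ω r t ht := by
  induction t with
  | zero => exact funext fun s => s.elim0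
  | succ t ih =>
    have hpast := ih (Nat.le_of_succ_le ht) fun s hs => h s (hs.trans t.lt_succ_self)
    have hup : ∀ i, C.map (ω ⟨t, ht⟩).1
        (A.uplink t i r (fun s => f (Fin.castLE ht s) i)
          (fun s => (transcript A C link f' ω r t (Nat.le_of_succ_le ht) s).up i)
          (fun s => (transcript A C link f' ω r t (Nat.le_of_succ_le ht) s).down)) =
        C.map (ω ⟨t, ht⟩).1
        (A.uplink t i r (fun s => f' (Fin.castLE ht s) i)
          (fun s => (transcript A C link f' ω r t (Nat.le_of_succ_le ht) s).up i)
          (fun s => (transcript A C link f' ω r t (Nat.le_of_succ_le ht) s).down)) := by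
      intro i
      -- A failed uplink sends `0` for either losses; at a successful one all losses up to now agree
      -- by hypothesis.
      cases hb : ok (ω ⟨t, ht⟩).1 with
      | false => rw [hok _ _ hb, hok _ _ hb]
      | true =>
        have : ∀ s : Fin (t + 1), f (Fin.castLE ht s) = f' (Fin.castLE ht s) := fun s =>
          h ⟨t, ht⟩ t.lt_succ_self hb _ (Fin.mk_le_mk.2 (Nat.le_of_lt_succ s.isLt))
        simp only [this]
    simp only [transcript, hpast, hup]

/-- Measurability in the seed with outcomes and losses held fixed is enough, as the outcomes will
form a countable space. -/
lemma measurable_transcript (f : Fin T → Fin n → Vec d → ℝ) (ω : C.Outcomes T) (t : ℕ)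
    (ht : t ≤ T) (s : Fin t) :
    (∀ i, Measurable fun r => (transcript A C link f ω r t ht s).up i) ∧
      Measurable fun r => (transcript A C link f ω r t ht s).down := by
  have hC : ∀ o, Measurable (C.map o) := fun o => C.measurable_map.comp measurable_prodMk_left
  induction t with
  | zero => exact s.elim0
  | succ t ih =>
    have ih' := ih (Nat.le_of_succ_le ht)
    have hdowns : Measurable fun r => fun s =>
        (transcript A C link f ω r t (Nat.le_of_succ_le ht) s).down :=
      measurable_pi_iff.2 fun s => (ih' s).2
    have hup : ∀ i, Measurable fun r => C.map (ω ⟨t, ht⟩).1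
        (A.uplink t i r (fun s => f (Fin.castLE ht s) i)
          (fun s => (transcript A C link f ω r t (Nat.le_of_succ_le ht) s).up i)
          (fun s => (transcript A C link f ω r t (Nat.le_of_succ_le ht) s).down)) := fun i =>
      (hC _).comp ((A.measurable_uplink t i fun s => f (Fin.castLE ht s) i).comp
        (measurable_id.prodMk ((measurable_pi_iff.2 fun s => (ih' s).1 i).prodMk hdowns)))
    refine Fin.lastCases ?_ (fun s => ?_) s
    · simp only [transcript, Fin.snoc_last]
      refine ⟨hup, ?_⟩
      have hb := (A.measurable_broadcast t).comp (measurable_id.prodMk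
        (Measurable.prodMk (f := fun r => Fin.snoc (α := fun _ => Fin n → Vec d)
          (fun s => (transcript A C link f ω r t (Nat.le_of_succ_le ht) s).up)
          fun i => C.map (ω ⟨t, ht⟩).1
            (A.uplink t i r (fun s => f (Fin.castLE ht s) i)
              (fun s => (transcript A C link f ω r t (Nat.le_of_succ_le ht) s).up i)
              (fun s => (transcript A C link f ω r t (Nat.le_of_succ_le ht) s).down)))
          (measurable_pi_iff.2 fun s => Fin.lastCases (by
            simp only [Fin.snoc_last]
            exact measurable_pi_iff.2 hup) (fun s => by
            simp only [Fin.snoc_castSucc]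
            exact measurable_pi_iff.2 (ih' s).1) s) hdowns))
      cases link with
      | exact => exact hb
      | compressed => exact (hC _).comp hb
    · simp only [transcript, Fin.snoc_castSucc]
      exact ih' s

lemma measurable_played (f : Fin T → Fin n → Vec d → ℝ) (ω : C.Outcomes T) (t : Fin T) :
    Measurable fun r => played A C link f ω r t :=
  (A.measurable_decision t).comp (measurable_id.prodMk
    (measurable_pi_iff.2 fun s => (measurable_transcript A C link f ω t t.isLt.le s).2))

lemma played_mem (f : Fin T → Fin n → Vec d → ℝ) (ω : C.Outcomes T) (r : A.Seed) (t : Fin T) :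
    played A C link f ω r t ∈ W :=
  A.decision_mem _ _ _

end Transcript

/-- Only the mean of the count is needed, because `1 / (N + 2)` will be bounded below by a function
affine in `N`. -/
lemma integral_successCount {d : ℕ} (C : Compressor d) [Countable C.Outcome]
    [MeasurableSingletonClass C.Outcome] (ok : C.Outcome → Bool) {δ : ℝ}
    (hδ : ∫ o, (if ok o = true then (1 : ℝ) else 0) ∂C.law = δ) {t T : ℕ} (ht : t ≤ T) :
    Integrable (fun ω : C.Outcomes T =>
      (successCount ok (fun s : Fin t => ω (Fin.castLE ht s)) : ℝ)) (C.outcomesLaw T) ∧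
    ∫ ω : C.Outcomes T, (successCount ok (fun s : Fin t => ω (Fin.castLE ht s)) : ℝ)
      ∂C.outcomesLaw T = δ * t := by
  have hm : Measurable fun o : C.Outcome => if ok o = true then (1 : ℝ) else 0 :=
    measurable_of_countable _
  have : IsProbabilityMeasure (C.outcomesLaw T) := by
    unfold Compressor.outcomesLaw
    infer_instance
  have hi : ∀ s : Fin T, Integrable (fun ω : C.Outcomes T =>
      if ok (ω s).1 = true then (1 : ℝ) else 0) (C.outcomesLaw T) := fun s =>
    Integrable.of_bound (hm.comp (measurable_fst.comp (measurable_pi_apply s))).aestronglyMeasurable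
      1 (.of_forall fun ω => by split_ifs <;> simp)
  have hv : ∀ s : Fin T, ∫ ω : C.Outcomes T,
      (if ok (ω s).1 = true then (1 : ℝ) else 0) ∂C.outcomesLaw T = δ := by
    intro s
    have h1 := integral_comp_eval (μ := fun _ : Fin T => C.law.prod C.law) (i := s)
      (f := fun o => if ok o.1 = true then (1 : ℝ) else 0)
      (hm.comp measurable_fst).aestronglyMeasurable
    have h2 := integral_fun_fst (μ := C.law) (ν := C.law)
      (fun o => if ok o = true then (1 : ℝ) else 0)
    rw [Compressor.outcomesLaw, h1, h2, hδ]
    simp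
  simp only [successCount_eq_sum]
  refine ⟨integrable_finsetSum _ fun s _ => hi _, ?_⟩
  rw [integral_finsetSum _ fun s _ => hi _]
  simp only [hv]
  simp [mul_comm]

/-! ### Quadratic losses with minimizers on the diagonal of the cube. -/

/-- The quadratic loss with curvature `μ` and minimizer `c`. -/
noncomputable def quadLoss {d : ℕ} (μ : ℝ) (c w : Vec d) : ℝ :=
  μ / 2 * ‖w - c‖ ^ 2

/-- The vertex `(D / √d, …, D / √d)` of the cube. -/
noncomputable def corner (d : ℕ) (D : ℝ) : Vec d :=
  WithLp.toLp 2 fun _ => D / Real.sqrt d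

lemma quadLoss_nonneg {d : ℕ} {μ : ℝ} (hμ : 0 ≤ μ) (c w : Vec d) : 0 ≤ quadLoss μ c w := by
  unfold quadLoss
  positivity

lemma hasGradientAt_quadLoss {d : ℕ} (μ : ℝ) (c w : Vec d) :
    HasGradientAt (quadLoss μ c) (μ • (w - c)) w := by
  rw [hasGradientAt_iff_hasFDerivAt]
  have h := (((hasFDerivAt_id (𝕜 := ℝ) w).sub_const c).norm_sq).const_mul (μ / 2)
  refine h.congr_fderiv ?_
  ext y
  simp
  ring

lemma stronglyConvexOver_quadLoss {d : ℕ} (W : Set (Vec d)) (μ : ℝ) (c : Vec d) :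
    StronglyConvexOver W μ (quadLoss μ c) := by
  refine ⟨fun x _ => (hasGradientAt_quadLoss μ c x).differentiableAt, fun x _ y _ => ?_⟩
  have h : y - c = (x - c) + (y - x) := by abel
  rw [(hasGradientAt_quadLoss μ c x).gradient, quadLoss, quadLoss, h, norm_add_sq_real,
    real_inner_smul_left]
  exact le_of_eq (by ring)

section Cube

variable {d : ℕ} (hd : 0 < d) {D : ℝ} (hD : 0 ≤ D)

include hd hD

lemma norm_corner : ‖corner d D‖ = D := by
  have hd' : (0 : ℝ) < d := by exact_mod_cast hd
  rw [← sq_eq_sq₀ (norm_nonneg _) hD, EuclideanSpace.norm_sq_eq]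
  simp [corner, div_pow]
  field_simp

lemma smul_corner_mem_cube {p : ℝ} (hp : p ∈ Set.Icc (0 : ℝ) 1) : p • corner d D ∈ cube d D := by
  have h : 0 ≤ D / Real.sqrt d := by positivity
  intro j
  simp only [corner, PiLp.smul_apply, smul_eq_mul]
  exact ⟨mul_nonneg hp.1 h, mul_le_of_le_one_left h hp.2⟩

lemma norm_sub_le_of_mem_cube {x y : Vec d} (hx : x ∈ cube d D) (hy : y ∈ cube d D) :
    ‖x - y‖ ≤ D := by
  have hd' : (0 : ℝ) < d := by exact_mod_cast hd
  refine abs_le_of_sq_le_sq' ?_ hD |>.2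
  rw [EuclideanSpace.norm_sq_eq]
  have h : ∀ j ∈ Finset.univ, ‖(x - y) j‖ ^ 2 ≤ (D / Real.sqrt d) ^ 2 := by
    intro j _
    rw [Real.norm_eq_abs, sq_abs, PiLp.sub_apply]
    refine sq_le_sq' ?_ ?_ <;> linarith [(hx j).1, (hx j).2, (hy j).1, (hy j).2]
  refine (Finset.sum_le_sum h).trans (le_of_eq ?_)
  simp [div_pow]
  field_simp

end Cube

lemma sum_bitWeight {ι : Type*} [Fintype ι] [DecidableEq ι] (s : Finset ι) (p : ℝ) :
    ∑ x, bitWeight s p x = 1 := by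
  simpa [bitMean] using bitMean_const s p 1

/-- The coordinate of `w` along the diagonal of the cube. -/
noncomputable def diagonalCoord {d : ℕ} (D : ℝ) (w : Vec d) : ℝ :=
  inner ℝ w (corner d D) / D ^ 2

/-- Cauchy–Schwarz against the corner: leaving the diagonal never helps, so the dimension plays no
role. -/
lemma quadLoss_corner_ge {d : ℕ} (hd : 0 < d) {D μ : ℝ} (hD : 0 < D) (hμ : 0 ≤ μ) (b : ℝ)
    (w : Vec d) :
    μ / 2 * D ^ 2 * (diagonalCoord D w - b) ^ 2 ≤ quadLoss μ (b • corner d D) w := by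
  have hn := norm_corner hd hD.le
  have hi : inner ℝ (w - b • corner d D) (corner d D) = D ^ 2 * (diagonalCoord D w - b) := by
    rw [inner_sub_left, real_inner_smul_left, real_inner_self_eq_norm_sq, hn, diagonalCoord]
    field_simp
  have hcs := abs_real_inner_le_norm (w - b • corner d D) (corner d D)
  rw [hi, hn, abs_mul, abs_of_pos (by positivity : 0 < D ^ 2)] at hcs
  have h1 : D * |diagonalCoord D w - b| ≤ ‖w - b • corner d D‖ := by
    nlinarith
  have h2 := pow_le_pow_left₀ (by positivity) h1 2
  rw [mul_pow, sq_abs] at h2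
  rw [quadLoss, mul_assoc]
  exact mul_le_mul_of_nonneg_left h2 (by positivity)

lemma quadLoss_corner_smul {d : ℕ} (hd : 0 < d) {D : ℝ} (hD : 0 < D) (μ p b : ℝ) :
    quadLoss μ (b • corner d D) (p • corner d D) = μ / 2 * D ^ 2 * (p - b) ^ 2 := by
  rw [quadLoss, ← sub_smul, norm_smul, norm_corner hd hD.le, mul_pow, Real.norm_eq_abs, sq_abs]
  ring

lemma average_losses_mem_Icc {n d T : ℕ} {W : Set (Vec d)} {f : Fin T → Fin n → Vec d → ℝ} {M : ℝ}
    (hM : 0 ≤ M) (hf : ∀ t i, ∀ w ∈ W, f t i w ∈ Set.Icc 0 M) {w : Fin T → Vec d}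
    (hw : ∀ t, w t ∈ W) :
    (1 / (n : ℝ)) * ∑ t, ∑ i, f t i (w t) ∈ Set.Icc 0 (T * M) := by
  constructor
  · exact mul_nonneg (by positivity) (Finset.sum_nonneg fun t _ => Finset.sum_nonneg fun i _ =>
      (hf t i _ (hw t)).1)
  · have h : ∑ t, ∑ i, f t i (w t) ≤ ∑ _t : Fin T, ∑ _i : Fin n, M :=
      Finset.sum_le_sum fun t _ => Finset.sum_le_sum fun i _ => (hf t i _ (hw t)).2
    refine (mul_le_mul_of_nonneg_left h (by positivity)).trans ?_
    rcases Nat.eq_zero_or_pos n with rfl | hn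
    · simp
      positivity
    · have : (0 : ℝ) < n := by exact_mod_cast hn
      simp
      field_simp
      exact le_rfl

lemma abs_regret_le {n d T : ℕ} {W : Set (Vec d)} {f : Fin T → Fin n → Vec d → ℝ} {M : ℝ}
    (hW : W.Nonempty) (hM : 0 ≤ M) (hf : ∀ t i, ∀ w ∈ W, f t i w ∈ Set.Icc 0 M)
    {w : Fin T → Vec d} (hw : ∀ t, w t ∈ W) : |regret W f w| ≤ T * M := by
  have hu : ∀ u : W, (1 / (n : ℝ)) * ∑ t, ∑ i, f t i (u : Vec d) ∈ Set.Icc 0 (T * M) :=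
    fun u => average_losses_mem_Icc hM hf fun _ => u.2
  have : Nonempty W := hW.to_subtype
  have h1 := average_losses_mem_Icc hM hf hw
  have h2 : 0 ≤ ⨅ u : W, (1 / (n : ℝ)) * ∑ t, ∑ i, f t i (u : Vec d) :=
    le_ciInf fun u => (hu u).1
  have h3 : (⨅ u : W, (1 / (n : ℝ)) * ∑ t, ∑ i, f t i (u : Vec d)) ≤ T * M :=
    (ciInf_le ⟨0, by rintro _ ⟨u, rfl⟩; exact (hu u).1⟩ ⟨hW.some, hW.some_mem⟩).trans (hu _).2
  rw [regret, abs_le]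
  exact ⟨by linarith [h1.1], by linarith [h1.2]⟩

/-- The regret against the points of the diagonal, when the minimizers lie on the diagonal. -/
lemma le_regret_quadLoss {n d T : ℕ} (hn : 0 < n) (hd : 0 < d) {D μ p : ℝ} (hD : 0 < D)
    (hμ : 0 ≤ μ) (hp : p ∈ Set.Icc (0 : ℝ) 1) (b : Fin T → ℝ) (w : Fin T → Vec d) :
    μ / 2 * D ^ 2 * ∑ t, ((diagonalCoord D (w t) - b t) ^ 2 - (p - b t) ^ 2) ≤
      regret (cube d D) (fun t (_ : Fin n) => quadLoss μ (b t • corner d D)) w := by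
  have hn' : (n : ℝ) ≠ 0 := by exact_mod_cast hn.ne'
  have havg : ∀ g : Fin T → ℝ, (1 / (n : ℝ)) * ∑ t, ∑ _i : Fin n, g t = ∑ t, g t := by
    intro g
    simp [← Finset.mul_sum]
    field_simp
  -- The comparator is the diagonal point `p • corner d D`, where `p` will be the mean of the bits.
  have hinf := ciInf_le (f := fun u : cube d D =>
      ∑ t, quadLoss μ (b t • corner d D) (u : Vec d))
    ⟨0, by rintro _ ⟨u, rfl⟩; exact Finset.sum_nonneg fun t _ => quadLoss_nonneg hμ _ _⟩
    ⟨p • corner d D, smul_corner_mem_cube hd hD.le hp⟩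
  simp only [quadLoss_corner_smul hd hD, ← Finset.mul_sum] at hinf
  rw [regret]
  simp only [havg]
  rw [Finset.sum_sub_distrib, mul_sub, Finset.mul_sum]
  exact sub_le_sub (Finset.sum_le_sum fun t _ => quadLoss_corner_ge hd hD hμ _ _) hinf

/-! ### The bit adversary and its regret for fixed randomness. -/

/-- The adversary that plays the quadratic loss of the next bit of `x` after every `ok` round. -/
noncomputable def bitAdversary {n d T : ℕ} {C : Compressor d} (ok : C.Outcome → Bool) (D μ : ℝ)
    (x : Fin T → Bool) : Adversary C n T :=
  fun t h _ => quadLoss μ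
    (bitValue (x ⟨successCount ok h, (successCount_le ok h).trans_lt t.isLt⟩) • corner d D)

lemma bitValue_mem_Icc (b : Bool) : bitValue b ∈ Set.Icc (0 : ℝ) 1 := by
  cases b <;> simp [bitValue]

lemma gradientsBounded_bitAdversary {n d T : ℕ} (hn : 0 < n) (hd : 0 < d) {C : Compressor d}
    (ok : C.Outcome → Bool) {D μ G : ℝ} (hD : 0 ≤ D) (hμ : 0 ≤ μ) (hG : μ * D ≤ G)
    (x : Fin T → Bool) (t : Fin T) (h : Fin t → C.Outcome × C.Outcome) :
    GradientsBounded (cube d D) G (bitAdversary (n := n) ok D μ x t h) := by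
  intro w hw
  have hn' : (n : ℝ) ≠ 0 := by exact_mod_cast hn.ne'
  have key : ∀ b, ‖μ • (w - bitValue b • corner d D)‖ ≤ G := by
    intro b
    rw [norm_smul, Real.norm_of_nonneg hμ]
    exact (mul_le_mul_of_nonneg_left (norm_sub_le_of_mem_cube hd hD hw
      (smul_corner_mem_cube hd hD (bitValue_mem_Icc b))) hμ).trans hG
  simp only [bitAdversary, (hasGradientAt_quadLoss μ _ w).gradient]
  refine ⟨fun _ => key _, ?_⟩
  rw [Finset.sum_const, Finset.card_univ, Fintype.card_fin, ← Nat.cast_smul_eq_nsmul ℝ, smul_smul,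
    one_div_mul_cancel hn', one_smul]
  exact key _

lemma bitAdversary_mem_Icc {n d T : ℕ} (hd : 0 < d) {C : Compressor d}
    (ok : C.Outcome → Bool) {D μ : ℝ} (hD : 0 ≤ D) (hμ : 0 ≤ μ)
    (x : Fin T → Bool) (t : Fin T) (h : Fin t → C.Outcome × C.Outcome) (i : Fin n) :
    ∀ w ∈ cube d D, bitAdversary (n := n) ok D μ x t h i w ∈ Set.Icc 0 (μ / 2 * D ^ 2) := by
  intro w hw
  refine ⟨quadLoss_nonneg hμ _ _, mul_le_mul_of_nonneg_left (pow_le_pow_left₀ (norm_nonneg _)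
    (norm_sub_le_of_mem_cube hd hD hw (smul_corner_mem_cube hd hD (bitValue_mem_Icc _))) 2)
    (by positivity)⟩

section Regret

variable {n d T : ℕ} (hn : 0 < n) (hd : 0 < d) {D μ : ℝ} (hD : 0 < D) (hμ : 0 ≤ μ)
  {C : Compressor d} (ok : C.Outcome → Bool) (A : DOCOAlgorithm n d (cube d D)) (link : Downlink)

/-- Before the next `ok` round nothing is known of the bit that governs the current loss. -/
lemma played_bitAdversary_congr (hok : ∀ ω x, ok ω = false → C.map ω x = 0) (x x' : Fin T → Bool)
    (ω : C.Outcomes T) (r : A.Seed) (t : Fin T)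
    (h : ∀ j : Fin T, (j : ℕ) < successCount ok (fun s : Fin t => ω (Fin.castLE t.isLt.le s)) →
      x j = x' j) :
    played A C link ((bitAdversary ok D μ x).losses ω) ω r t =
      played A C link ((bitAdversary ok D μ x').losses ω) ω r t := by
  rw [played, played, transcript_congr A C link hok _ ((bitAdversary ok D μ x').losses ω)]
  intro s hs hb s' hs'
  -- A loss revealed by a successful round `s < t` uses a bit of index at most the count before `s`,
  -- and that success makes the count before `t` strictly larger.
  have hlt := (successCount_mono ok (Fin.le_def.1 hs') s.isLt.le ω).trans_lt
    (successCount_lt ok hs t.isLt.le ω hb)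
  exact funext fun _ =>
    congrArg (fun b => quadLoss μ (bitValue b • corner d D)) (h ⟨_, _⟩ hlt)

include hd hD hμ

lemma abs_algorithmRegret_bitAdversary_le (x : Fin T → Bool) (p : A.Seed × C.Outcomes T) :
    |algorithmRegret A C link (bitAdversary ok D μ x) p| ≤ T * (μ / 2 * D ^ 2) :=
  abs_regret_le ⟨_, smul_corner_mem_cube hd hD.le (p := 0) (by simp)⟩ (by positivity)
    (fun t i => bitAdversary_mem_Icc hd ok hD.le hμ x t _ i) (played_mem A C link _ _ _)

lemma integrable_algorithmRegret_bitAdversary [Countable C.Outcome]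
    [MeasurableSingletonClass C.Outcome] (x : Fin T → Bool) :
    Integrable (algorithmRegret A C link (bitAdversary ok D μ x))
      (A.seedLaw.prod (C.outcomesLaw T)) := by
  have : IsProbabilityMeasure (C.outcomesLaw T) := by
    unfold Compressor.outcomesLaw
    infer_instance
  refine Integrable.of_bound (Measurable.aestronglyMeasurable ?_) (T * (μ / 2 * D ^ 2))
    (.of_forall fun p => abs_algorithmRegret_bitAdversary_le hd hD hμ ok A link x p)
  -- Outcomes are countable, so it suffices to treat each `ω` separately, with the losses then
  -- fixed.
  refine measurable_from_prod_countable_left fun ω => ?_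
  have hc : ∀ c : Vec d, Measurable (quadLoss μ c) := fun c => by
    unfold quadLoss
    fun_prop
  have hsum : Measurable fun r => ∑ t : Fin T, ∑ i : Fin n, (bitAdversary ok D μ x).losses ω t i
      (played A C link ((bitAdversary ok D μ x).losses ω) ω r t) :=
    Finset.measurable_fun_sum _ fun t _ => Finset.measurable_fun_sum _ fun i _ =>
      (hc _).comp (measurable_played A C link _ ω t)
  exact (hsum.const_mul (1 / (n : ℝ))).sub_const (⨅ u : cube d D,
    (1 / (n : ℝ)) * ∑ t, ∑ i, (bitAdversary ok D μ x).losses ω t i (u : Vec d))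

include hn

/-- With seed and outcomes fixed, the decisions are functions of `x` alone and the one-bit bound
applies in each round. The weights are the law of `x` when `p` is uniform; `1 / 12` is `1 / 2` from
the loss times `1 / 6` from the prediction bound. -/
lemma bitMean_regret_ge (hok : ∀ ω x, ok ω = false → C.map ω x = 0) (r : A.Seed)
    (ω : C.Outcomes T) :
    μ * D ^ 2 / 12 * ∑ t : Fin T,
      1 / ((successCount ok (fun s : Fin t => ω (Fin.castLE t.isLt.le s)) : ℝ) + 2) ≤
    ∑ x : Fin T → Bool, (∫ p in (0 : ℝ)..1, bitWeight Finset.univ p x) *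
      algorithmRegret A C link (bitAdversary ok D μ x) (r, ω) := by
  set N : Fin T → Fin T := fun t =>
    ⟨successCount ok (fun s : Fin t => ω (Fin.castLE t.isLt.le s)),
      (successCount_le ok _).trans_lt t.isLt⟩ with hN
  set a : Fin T → (Fin T → Bool) → ℝ := fun t x =>
    diagonalCoord D (played A C link ((bitAdversary ok D μ x).losses ω) ω r t)
  set R : (Fin T → Bool) → ℝ := fun x =>
    algorithmRegret A C link (bitAdversary ok D μ x) (r, ω)
  have hround : ∀ t : Fin T, 1 / (6 * ((N t : ℕ) + 2 : ℝ)) ≤ ∫ p in (0 : ℝ)..1,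
      bitMean Finset.univ p
        (fun x => (a t x - bitValue (x (N t))) ^ 2 - (p - bitValue (x (N t))) ^ 2) := by
    intro t
    -- The bits already revealed are those of index below `N t`, hence `N t` many.
    have h := le_integral_bitMean_excess (s := Finset.Iio (N t)) (k := N t) (a := a t) (by simp)
      fun j hj x b => by
        refine congrArg (diagonalCoord D)
          (played_bitAdversary_congr ok A link hok _ _ ω r t fun i hi => ?_)
        refine Function.update_of_ne ?_ _ _
        rintro rfl
        exact hj (Finset.mem_Iio.2 (Fin.lt_def.2 hi))
    rwa [Fin.card_Iio] at h
  have hpt : ∀ p ∈ Set.Icc (0 : ℝ) 1, ∑ t, μ / 2 * D ^ 2 * bitMean Finset.univ p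
      (fun x => (a t x - bitValue (x (N t))) ^ 2 - (p - bitValue (x (N t))) ^ 2) ≤
      bitMean Finset.univ p R := by
    intro p hp
    refine le_trans (le_of_eq ?_) (bitMean_mono Finset.univ hp fun x =>
      le_regret_quadLoss hn hd hD hμ hp (fun t => bitValue (x (N t)))
        fun t => played A C link ((bitAdversary ok D μ x).losses ω) ω r t)
    rw [bitMean_const_mul, ← Finset.mul_sum]
    simp only [bitMean, Finset.mul_sum]
    rw [Finset.sum_comm]
  have hcont : ∀ t, Continuous fun p : ℝ => bitMean Finset.univ p
      (fun x => (a t x - bitValue (x (N t))) ^ 2 - (p - bitValue (x (N t))) ^ 2) := fun t =>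
    continuous_bitMean _ fun x => by fun_prop
  have hint := intervalIntegral.integral_mono_on (μ := volume) zero_le_one
    (Continuous.intervalIntegrable
      (continuous_finsetSum Finset.univ fun t _ => (hcont t).const_mul (μ / 2 * D ^ 2)) 0 1)
    ((continuous_bitMean Finset.univ (F := fun _ => R) fun x => continuous_const).intervalIntegrable 0 1) hpt
  rw [intervalIntegral.integral_finsetSum fun t _ =>
    ((hcont t).const_mul (μ / 2 * D ^ 2)).intervalIntegrable 0 1] at hint
  simp only [intervalIntegral.integral_const_mul] at hint
  have hR' : ∫ p in (0 : ℝ)..1, bitMean Finset.univ p R =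
      ∑ x, (∫ p in (0 : ℝ)..1, bitWeight Finset.univ p x) * R x := by
    simp only [bitMean]
    rw [intervalIntegral.integral_finsetSum]
    swap
    · exact fun x _ => Continuous.intervalIntegrable
        ((continuous_bitWeight _ x).mul continuous_const) 0 1
    simp only [intervalIntegral.integral_mul_const]
  rw [← hR']
  refine le_trans ?_ hint
  rw [Finset.mul_sum]
  refine Finset.sum_le_sum fun t _ => ?_
  refine le_trans (le_of_eq ?_) (mul_le_mul_of_nonneg_left (hround t) (by positivity))
  have : ((N t : ℕ) : ℝ) + 2 ≠ 0 := by positivity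
  simp only [hN] at this ⊢
  field_simp
  ring

end Regret

/-! ### The dropping compressor. -/

/-- The compressor that transmits its argument with probability `δ` and `0` otherwise. -/
noncomputable def dropCompressor (d : ℕ) (δ : ℝ) (hδ0 : 0 ≤ δ) (hδ1 : δ ≤ 1) : Compressor d where
  Outcome := Bool
  law := ENNReal.ofReal δ • Measure.dirac true + ENNReal.ofReal (1 - δ) • Measure.dirac false
  isProbability := ⟨by
    simp [← ENNReal.ofReal_add hδ0 (sub_nonneg.2 hδ1)]⟩
  map b x := if b then x else 0
  measurable_map := measurable_from_prod_countable_right fun b => by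
    cases b
    · exact measurable_const
    · exact measurable_id

lemma integral_dropCompressor {d : ℕ} {δ : ℝ} (hδ0 : 0 ≤ δ) (hδ1 : δ ≤ 1) (g : Bool → ℝ) :
    ∫ b : Bool, g b ∂(dropCompressor d δ hδ0 hδ1).law = δ * g true + (1 - δ) * g false := by
  have hi : ∀ (c : ℝ) (b : Bool), Integrable g (ENNReal.ofReal c • Measure.dirac b) := fun c b =>
    (integrable_dirac (by simp)).smul_measure ENNReal.ofReal_ne_top
  refine (integral_add_measure (hi _ _) (hi _ _)).trans ?_
  rw [integral_smul_measure, integral_smul_measure, integral_dirac, integral_dirac,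
    ENNReal.toReal_ofReal hδ0, ENNReal.toReal_ofReal (sub_nonneg.2 hδ1), smul_eq_mul, smul_eq_mul]

lemma isContractive_dropCompressor {d : ℕ} {δ : ℝ} (hδ0 : 0 ≤ δ) (hδ1 : δ ≤ 1) :
    (dropCompressor d δ hδ0 hδ1).IsContractive δ := by
  intro x
  constructor
  · have : Finite (dropCompressor d δ hδ0 hδ1).Outcome := inferInstanceAs (Finite Bool)
    have : MeasurableSingletonClass (dropCompressor d δ hδ0 hδ1).Outcome :=
      inferInstanceAs (MeasurableSingletonClass Bool)
    exact Integrable.of_finite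
  · refine le_of_eq ((integral_dropCompressor hδ0 hδ1
      fun b => ‖(if b then x else 0) - x‖ ^ 2).trans ?_)
    simp

/-! ### Real inequalities for the final bound. -/

lemma log_div_le_sum {δ : ℝ} (hδ : 0 < δ) (T : ℕ) :
    Real.log (1 + δ * T / 2) / δ ≤ ∑ t : Fin T, 1 / (δ * (t : ℕ) + 2) := by
  rw [Fin.sum_univ_eq_sum_range fun t => 1 / (δ * (t : ℝ) + 2)]
  induction T with
  | zero => simp
  | succ T ih =>
    rw [Finset.sum_range_succ]
    refine le_trans ?_ (add_le_add_left ih _)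
    have h1 : 0 < 1 + δ * T / 2 := by positivity
    have h2 : 0 < δ * T + 2 := by positivity
    have h3 : 0 < 1 + δ * ((T + 1 : ℕ) : ℝ) / 2 := by positivity
    -- Each increment of the logarithm is at most the ratio of its arguments minus one, which is `δ`
    -- times the new summand.
    have h := Real.log_le_sub_one_of_pos (div_pos h3 h1)
    rw [Real.log_div h3.ne' h1.ne'] at h
    have heq : (1 + δ * ((T + 1 : ℕ) : ℝ) / 2) / (1 + δ * T / 2) - 1 = δ * (1 / (δ * T + 2)) := by
      push_cast
      field_simp
      ring
    rw [heq] at h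
    rw [div_add' _ _ _ hδ.ne', div_le_div_iff_of_pos_right hδ]
    linarith

lemma logb_bound {D μ δ y : ℝ} (hμ : 0 ≤ μ) (hδ : 0 < δ) (hy : 0 < y) :
    μ * D ^ 2 * (Real.logb 16 (15 * y) - 2) / (2 ^ 18 * δ) ≤
      μ * D ^ 2 / 12 * (Real.log (1 + y / 2) / δ) := by
  have h16 : 1 ≤ Real.log 16 := by
    rw [Real.le_log_iff_exp_le (by norm_num)]
    linarith [Real.exp_one_lt_d9]
  have h0 : 0 ≤ Real.log (1 + y / 2) := Real.log_nonneg (by linarith)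
  -- The `2` is `log₁₆ 256`, and `15 y / 256 ≤ 1 + y / 2`; passing to the natural logarithm uses
  -- `log 16 ≥ 1`.
  have h2 : Real.logb 16 (15 * y) - 2 ≤ Real.log (1 + y / 2) := by
    have h256 : Real.log 256 = 2 * Real.log 16 := by
      rw [show (256 : ℝ) = 16 ^ 2 by norm_num, Real.log_pow]
      norm_num
    have hle : Real.log (15 * y) - Real.log 256 ≤ Real.log (1 + y / 2) := by
      rw [← Real.log_div (by positivity) (by norm_num)]
      exact Real.log_le_log (by positivity) (by linarith)
    rw [Real.logb, sub_le_iff_le_add, div_le_iff₀ (by linarith)]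
    nlinarith
  have hc : 0 ≤ μ * D ^ 2 / δ := by positivity
  calc μ * D ^ 2 * (Real.logb 16 (15 * y) - 2) / (2 ^ 18 * δ)
      = μ * D ^ 2 / δ * ((Real.logb 16 (15 * y) - 2) / 2 ^ 18) := by field_simp
    _ ≤ μ * D ^ 2 / δ * (Real.log (1 + y / 2) / 12) :=
        mul_le_mul_of_nonneg_left (by linarith) hc
    _ = _ := by ring

/-- The convex function `1 / m` lies above its tangent at `c`; with `c` the mean of `m` this gives
Jensen's inequality. -/
lemma one_div_tangent {c m : ℝ} (hc : 0 < c) (hm : 0 < m) : 2 / c - m / c ^ 2 ≤ 1 / m := by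
  have h : 1 / m - (2 / c - m / c ^ 2) = (m - c) ^ 2 / (m * c ^ 2) := by
    field_simp
    ring
  have : 0 ≤ (m - c) ^ 2 / (m * c ^ 2) := by positivity
  linarith

/-! ### Averaging over bits and outcomes. -/

/-- If every uplink gets through with probability `δ` only, then some bits force regret. -/
lemma exists_bits_regret_ge {n d T : ℕ} (hn : 0 < n) (hd : 0 < d) {D μ δ : ℝ} (hD : 0 < D)
    (hμ : 0 ≤ μ) (hδ0 : 0 < δ) {C : Compressor d} [Countable C.Outcome]
    [MeasurableSingletonClass C.Outcome] (ok : C.Outcome → Bool)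
    (hok : ∀ ω x, ok ω = false → C.map ω x = 0)
    (hδ : ∫ o, (if ok o = true then (1 : ℝ) else 0) ∂C.law = δ)
    (A : DOCOAlgorithm n d (cube d D)) (link : Downlink) :
    ∃ x : Fin T → Bool, μ * D ^ 2 / 12 * (Real.log (1 + δ * T / 2) / δ) ≤
      ∫ p, algorithmRegret A C link (bitAdversary ok D μ x) p
        ∂(A.seedLaw.prod (C.outcomesLaw T)) := by
  have : IsProbabilityMeasure (C.outcomesLaw T) := by
    unfold Compressor.outcomesLaw
    infer_instance
  set P := A.seedLaw.prod (C.outcomesLaw T)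
  set E : (Fin T → Bool) → ℝ := fun x =>
    ∫ p, algorithmRegret A C link (bitAdversary ok D μ x) p ∂P with hE
  set wt : (Fin T → Bool) → ℝ := fun x => ∫ p in (0 : ℝ)..1, bitWeight Finset.univ p x with hwt
  have hwt0 : ∀ x, 0 ≤ wt x := fun x =>
    intervalIntegral.integral_nonneg zero_le_one fun p hp => bitWeight_nonneg _ hp x
  have hwt1 : ∑ x, wt x = 1 := by
    simp only [hwt]
    rw [← intervalIntegral.integral_finsetSum fun x _ =>
      (continuous_bitWeight _ x).intervalIntegrable 0 1]
    simp [sum_bitWeight]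
  have hint := integrable_algorithmRegret_bitAdversary (T := T) hd hD hμ ok A link
  set N : Fin T → C.Outcomes T → ℝ := fun t ω =>
    (successCount ok (fun s : Fin t => ω (Fin.castLE t.isLt.le s)) : ℝ)
  -- `c t` is the mean of `N t + 2`, the point at which the tangent is taken.
  set c : Fin T → ℝ := fun t => δ * (t : ℕ) + 2
  have hc0 : ∀ t, 0 < c t := fun t => by positivity
  have hNi : ∀ t, Integrable (fun ω => 2 / c t - (N t ω + 2) / c t ^ 2) (C.outcomesLaw T) :=
    fun t => (integrable_const _).sub
      (((integral_successCount C ok hδ t.isLt.le).1.add (integrable_const _)).div_const _)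
  have hNv : ∀ t, ∫ ω, (2 / c t - (N t ω + 2) / c t ^ 2) ∂C.outcomesLaw T = 1 / c t := by
    intro t
    have hi : Integrable (N t) (C.outcomesLaw T) := (integral_successCount C ok hδ t.isLt.le).1
    have hv : ∫ ω, N t ω ∂C.outcomesLaw T = δ * (t : ℕ) :=
      (integral_successCount C ok hδ t.isLt.le).2
    have hq : Integrable (fun ω => (N t ω + 2) / c t ^ 2) (C.outcomesLaw T) :=
      (hi.add (integrable_const _)).div_const _
    rw [integral_sub (integrable_const _) hq, integral_const, integral_div, integral_add hi (integrable_const _), hv]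
    simp only [integral_const, probReal_univ, one_smul]
    have := (hc0 t).ne'
    change 2 / c t - c t / c t ^ 2 = 1 / c t
    field_simp
    norm_num
  have hlow : ∫ p : A.Seed × C.Outcomes T,
      (μ * D ^ 2 / 12 * ∑ t, (2 / c t - (N t p.2 + 2) / c t ^ 2)) ∂P =
      μ * D ^ 2 / 12 * ∑ t, 1 / c t := by
    rw [integral_fun_snd (μ := A.seedLaw) (ν := C.outcomesLaw T)
      (fun ω => μ * D ^ 2 / 12 * ∑ t, (2 / c t - (N t ω + 2) / c t ^ 2)),
      integral_const_mul, integral_finsetSum _ fun t _ => hNi t]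
    simp [hNv]
  have hmean : μ * D ^ 2 / 12 * ∑ t, 1 / c t ≤ ∑ x, wt x * E x := by
    have hsum : ∑ x, wt x * E x = ∫ p, ∑ x, wt x *
        algorithmRegret A C link (bitAdversary ok D μ x) p ∂P := by
      rw [integral_finsetSum _ fun x _ => (hint x).const_mul _]
      simp only [hE, integral_const_mul]
      rfl
    rw [hsum, ← hlow]
    refine integral_mono
      (((integrable_finsetSum _ fun t _ => hNi t).const_mul _).comp_snd A.seedLaw)
      (integrable_finsetSum _ fun x _ => (hint x).const_mul _) fun p => ?_
    refine le_trans (mul_le_mul_of_nonneg_left (Finset.sum_le_sum fun t _ => ?_) (by positivity))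
      (bitMean_regret_ge hn hd hD hμ ok A link hok p.1 p.2)
    exact one_div_tangent (hc0 t) (by positivity)
  -- The weights are nonnegative and sum to `1`, so the worst string has at least the average
  -- regret.
  obtain ⟨x, hx⟩ := Finite.exists_max E
  refine ⟨x, ?_⟩
  calc μ * D ^ 2 / 12 * (Real.log (1 + δ * T / 2) / δ)
      ≤ μ * D ^ 2 / 12 * ∑ t, 1 / c t :=
        mul_le_mul_of_nonneg_left (log_div_le_sum hδ0 T) (by positivity)
    _ ≤ ∑ y, wt y * E y := hmean
    _ ≤ ∑ y, wt y * E x :=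
        Finset.sum_le_sum fun y _ => mul_le_mul_of_nonneg_left (hx y) (hwt0 y)
    _ = E x := by rw [← Finset.sum_mul, hwt1, one_mul]

theorem theorem4 (n d T : ℕ) (hn : 0 < n) (hd : 0 < d) (D μ G δ : ℝ)
    (hD : 0 < D) (hμ : 0 < μ) (hG : μ * D ≤ G) (hδ0 : 0 < δ) (hδ1 : δ ≤ 1)
    (hT : (16 + δ) / δ ≤ (T : ℝ)) (link : Downlink)
    (A : Compressor d → DOCOAlgorithm n d (cube d D)) :
    ∃ (C : Compressor d) (adv : Adversary C n T),
      C.IsContractive δ ∧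
      (∀ t h i, StronglyConvexOver (cube d D) μ (adv t h i)) ∧
      (∀ t h, GradientsBounded (cube d D) G (adv t h)) ∧
      Integrable (algorithmRegret (A C) C link adv) ((A C).seedLaw.prod (C.outcomesLaw T)) ∧
      μ * D ^ 2 * (Real.logb 16 (15 * δ * T) - 2) / (2 ^ 18 * δ) ≤
        ∫ p, algorithmRegret (A C) C link adv p ∂((A C).seedLaw.prod (C.outcomesLaw T)) := by
  have hT0 : (0 : ℝ) < T := lt_of_lt_of_le (by positivity) hT
  set C := dropCompressor d δ hδ0.le hδ1
  have : Countable C.Outcome := inferInstanceAs (Countable Bool)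
  have : MeasurableSingletonClass C.Outcome := inferInstanceAs (MeasurableSingletonClass Bool)
  let ok : C.Outcome → Bool := fun b : Bool => b
  have hok : ∀ ω x, ok ω = false → C.map ω x = 0 := by
    rintro (_ | _) x h
    · rfl
    · cases h
  have hδ : ∫ o, (if ok o = true then (1 : ℝ) else 0) ∂C.law = δ := by
    refine (integral_dropCompressor hδ0.le hδ1 fun b => if b = true then 1 else 0).trans ?_
    simp
  obtain ⟨x, hx⟩ := exists_bits_regret_ge (T := T) hn hd hD hμ.le hδ0 ok hok hδ (A C) link
  refine ⟨C, bitAdversary ok D μ x, isContractive_dropCompressor hδ0.le hδ1,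
    fun t h i => stronglyConvexOver_quadLoss _ _ _,
    gradientsBounded_bitAdversary hn hd ok hD.le hμ.le hG x,
    integrable_algorithmRegret_bitAdversary hd hD hμ.le ok (A C) link x, le_trans ?_ hx⟩
  rw [mul_assoc 15]
  exact logb_bound hμ.le hδ0 (by positivity)
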